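/- **Definitions.** A complete mapping of an additive group $G$ is a permutation $f$ of $G$ such that $x\mapsto f(x)+x$ is also a permutation of $G$. For a permutation $\sigma$ of a finite set $\Omega$, the cycle type $\operatorname{CT}(\sigma)$ is the monomial $\prod_{\ell=1}^{|\Omega|}x_\ell^{k_\ell}\in\mathbb{Q}[x_n:n\ge1]$, where $k_\ell$ is the number of cycles of $\sigma$ of length $\ell$ (fixed points being cycles of length $1$); for a set $X$ of permutations, $\operatorname{CT}(X)=\{\operatorname{CT}(\sigma):\sigma\in X\}$. $\operatorname{BU}_\ell$ is the $\mathbb{Q}$-algebra endomorphism of $\mathbb{Q}[x_n:n\ge1]$ with $x_n\mapsto x_{\ell n}$. For a subspace $W$ of a $K$-vector space $V$, a map $f:V\to V$ is $W$-coset-wise $K$-affine if for each coset $C$ of $W$ there are $v_C\in V$ and $\varphi_C\in\operatorname{End}_K(V)$ with $\varphi_C(W)\subseteq W$ and $f(x)=\varphi_C(x)+v_C$ for all $x\in C$. For a prime $p$ and $d\geq 1$, elements of $\mathbb{F}_p^d$ are row vectors, and for $M\in\operatorname{GL}_d(p)$, $v\in\mathbb{F}_p^d$ let $\lambda(M,v)$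 be the permutation $x\mapsto xM+v$ of $\mathbb{F}_p^d$; $\operatorname{AGL}_d(p)$ is the set of all $\lambda(M,v)$; $\operatorname{CGL}_d(p)$ is the set of $A\in\operatorname{GL}_d(p)$ not having $-1$ as an eigenvalue; $\operatorname{ACGL}_d(p)$ is the set of all $\lambda(A,v)$ with $A\in\operatorname{CGL}_d(p)$. Put $$\Gamma(d,p,\ell)=\begin{cases}\operatorname{CT}(\operatorname{ACGL}_d(p)),&\ell=1,\\ \operatorname{CT}(\operatorname{AGL}_d(p)),&\ell\ge2,\ (d,p)\notin\{(1,2),(1,3),(2,2)\},\\ \emptyset,&\ell\ge2,\ (d,p)=(1,2),\\ \{x_1^3,x_3\},&\ell\ge2,\ (d,p)=(1,3),\\ \{x_1^4,x_2^2,x_1x_3\},&\ell\ge2,\ (d,p)=(2,2).\end{cases}$$ **Theorem.** Let $p$ be a prime, let $d,t$ be positive integers, and let $g$ be a complete mapping of $\mathbb{F}_p^t$ of cycle type $x_1^{k_1}x_2^{k_2}\cdots x_{p^t}^{k_{p^t}}$. For $\ell=1,\dots,p^t$ and $i=1,\dots,k_\ell$ let $\gamma_{\ell,i}\in\Gamma(d,p,\ell)$.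 1. For every $d$-dimensional subspace $W$ of $\mathbb{F}_p^{d+t}$ there is a $W$-coset-wise $\mathbb{F}_p$-affine complete mapping of $\mathbb{F}_p^{d+t}$ of cycle type $\prod_{\ell=1}^{p^t}\prod_{i=1}^{k_\ell}\operatorname{BU}_\ell(\gamma_{\ell,i})$. 2. For all $\ell,i$ there are $M_{\ell,i,0},\dots,M_{\ell,i,\ell-1}\in\operatorname{CGL}_d(p)$ and $w_{\ell,i}\in\mathbb{F}_p^d$ with $\gamma_{\ell,i}=\operatorname{CT}(\lambda(M_{\ell,i,0}\cdots M_{\ell,i,\ell-1},w_{\ell,i}))$. 3. Let $\zeta_{\ell,i}=(u_{\ell,i,0},\dots,u_{\ell,i,\ell-1})$, for $1\le\ell\le p^t$ and $1\le i\le k_\ell$, be an enumeration of the cycles of $g$, and choose any $M_{\ell,i,j}$, $w_{\ell,i}$ as in 2. For $u=u_{\ell,i,j}\in\mathbb{F}_p^t$ put $\alpha_u=M_{\ell,i,j}$; $\omega_u=0$ if $j<\ell-1$ and $\omega_u=w_{\ell,i}$ if $j=\ell-1$; and $\nu_u=u_{\ell,i,(j+1)\bmod\ell}-u$. Identify $\mathbb{F}_p^d\oplus\mathbb{F}_p^t$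 with $\mathbb{F}_p^{d+t}$ by any linear isomorphism, and let $W$ be the subspace that corresponds to $\mathbb{F}_p^d\oplus 0$. Then $$(w,u)\mapsto(w\,\alpha_u+\omega_u,\;u+\nu_u)$$ is a $W$-coset-wise $\mathbb{F}_p$-affine complete mapping of $\mathbb{F}_p^{d+t}$ of cycle type $\prod_{\ell=1}^{p^t}\prod_{i=1}^{k_\ell}\operatorname{BU}_\ell(\gamma_{\ell,i})$. -/

import Mathlib

namespace CompleteMappings

open Matrix MvPolynomial

noncomputable section

/-- A complete mapping of an additive group `G`: a permutation `f` of `G` such that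
`x ↦ f x + x` is a permutation of `G` as well. -/
def IsCompleteMapping {G : Type*} [AddGroup G] (f : G → G) : Prop :=
  Function.Bijective f ∧ Function.Bijective (fun x => f x + x)

/-- `f : V → V` is `W`-coset-wise `K`-affine: on each coset `C` of `W` it agrees with
`x ↦ φ x + v` for some vector `v` and some endomorphism `φ` of `V` with `φ(W) ⊆ W`. -/
def IsCosetwiseAffine {K V : Type*} [Field K] [AddCommGroup V] [Module K V]
    (W : Submodule K V) (f : V → V) : Prop :=
  ∀ C : V ⧸ W, ∃ (v : V) (φ : Module.End K V),
    (∀ w ∈ W, φ w ∈ W) ∧ ∀ x : V, W.mkQ x = C → f x = φ x + v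

/-- The positive integers `1, 2, …, N` (possible cycle lengths of a permutation of `N` points). -/
abbrev Len (N : ℕ) : Type := {ℓ : ℕ+ // (ℓ : ℕ) ≤ N}

instance (N : ℕ) : Fintype (Len N) :=
  Fintype.subtype ((Finset.range N).image Nat.succPNat) fun ℓ => by
    simp only [Finset.mem_image, Finset.mem_range]
    constructor
    · rintro ⟨n, hn, rfl⟩
      exact hn
    · intro h
      exact ⟨ℓ.natPred, by have := ℓ.natPred_add_one; omega, PNat.succPNat_natPred ℓ⟩

/-- The number of cycles of length `ℓ` of `σ` (fixed points are the cycles of length `1`);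
the cycles are represented by their underlying sets of points. -/
def cycleCount {Ω : Type*} (σ : Equiv.Perm Ω) (ℓ : ℕ) : ℕ :=
  {c : Set Ω | (∃ x, c = {y | σ.SameCycle x y}) ∧ c.ncard = ℓ}.ncard

/-- The cycle type of a permutation `σ` of a finite set `Ω`, i.e. the monomial
`x₁ ^ k₁ * x₂ ^ k₂ * ⋯ * x_N ^ k_N` of `ℚ[xₙ : n ≥ 1]`, where `N = |Ω|` and `k_ℓ` is the number
of cycles of `σ` of length `ℓ`. -/
def CT {Ω : Type*} [Finite Ω] (σ : Equiv.Perm Ω) : MvPolynomial ℕ+ ℚ :=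
  ∏ ℓ : Len (Nat.card Ω), X ℓ.1 ^ cycleCount σ ℓ.1

/-- The `ℓ`-blow-up function, i.e. the `ℚ`-algebra endomorphism with `xₙ ↦ x_{ℓ n}`. -/
def BU (ℓ : ℕ+) : MvPolynomial ℕ+ ℚ →ₐ[ℚ] MvPolynomial ℕ+ ℚ :=
  rename fun n => ℓ * n

/-- The affine permutation `λ(M, v) : x ↦ x M + v` of the space of row vectors `F ^ d`, for an
invertible matrix `M`. -/
def affinePerm {F : Type*} [Field F] {d : ℕ} (M : GL (Fin d) F) (v : Fin d → F) :
    Equiv.Perm (Fin d → F) where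
  toFun x := x ᵥ* (M : Matrix (Fin d) (Fin d) F) + v
  invFun y := (y - v) ᵥ* ((M⁻¹ : GL (Fin d) F) : Matrix (Fin d) (Fin d) F)
  left_inv x := by
    simp only [add_sub_cancel_right, vecMul_vecMul]
    rw [← Units.val_mul, mul_inv_cancel, Units.val_one, vecMul_one]
  right_inv y := by
    simp only [vecMul_vecMul]
    rw [← Units.val_mul, inv_mul_cancel, Units.val_one, vecMul_one, sub_add_cancel]

/-- The affine permutations of `F ^ d`. -/
def AGL (d : ℕ) (F : Type*) [Field F] : Set (Equiv.Perm (Fin d → F)) :=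
  {σ | ∃ (M : GL (Fin d) F) (v : Fin d → F), σ = affinePerm M v}

/-- The invertible matrices that do not have `-1` as an eigenvalue. -/
def CGL (d : ℕ) (F : Type*) [Field F] : Set (GL (Fin d) F) :=
  {A | ¬ Module.End.HasEigenvalue
    (vecMulLinear (A : Matrix (Fin d) (Fin d) F) : Module.End F (Fin d → F)) (-1)}

/-- The affine permutations of `F ^ d` whose linear part lies in `CGL d F`. -/
def ACGL (d : ℕ) (F : Type*) [Field F] : Set (Equiv.Perm (Fin d → F)) :=
  {σ | ∃ A ∈ CGL d F, ∃ v : Fin d → F, σ = affinePerm A v}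

/-- The set `Γ(d, p, ℓ)` of cycle types. -/
def Gam (d p : ℕ) [Fact p.Prime] (ℓ : ℕ+) : Set (MvPolynomial ℕ+ ℚ) :=
  if ℓ = 1 then CT '' ACGL d (ZMod p)
  else if (d, p) = (1, 2) then ∅
  else if (d, p) = (1, 3) then {X 1 ^ 3, X 3}
  else if (d, p) = (2, 2) then {X 1 ^ 4, X 2 ^ 2, X 1 * X 3}
  else CT '' AGL d (ZMod p)

/-! The explicit construction. A permutation of `U = F ^ t` with `k ℓ` cycles of length `ℓ` is
enumerated by `u : CycleIndex k ≃ U`, the `i`-th cycle of length `ℓ` being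
`(u ⟨ℓ, i, 0⟩, u ⟨ℓ, i, 1⟩, …, u ⟨ℓ, i, ℓ - 1⟩)`. -/

/-- Triples `(ℓ, i, j)`: a length `ℓ`, the index `i` of a cycle of length `ℓ`, and a position `j`
in this cycle. -/
abbrev CycleIndex {N : ℕ} (k : Len N → ℕ) : Type :=
  Σ ℓ : Len N, Fin (k ℓ) × Fin (ℓ.1 : ℕ)

/-- The triple `(ℓ, i, (j + 1) mod ℓ)`. -/
def CycleIndex.next {N : ℕ} {k : Len N → ℕ} (c : CycleIndex k) : CycleIndex k :=
  ⟨c.1, c.2.1, ⟨((c.2.2 : ℕ) + 1) % (c.1.1 : ℕ), Nat.mod_lt _ c.1.1.pos⟩⟩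

section Explicit

variable {F : Type*} [Field F] {d N : ℕ} {U : Type*} [AddCommGroup U] {k : Len N → ℕ}

/-- `α_x` is multiplication by `M_{ℓ,i,j}`, where `x = u_{ℓ,i,j}`. -/
def alpha (u : CycleIndex k ≃ U) (M : ∀ ℓ : Len N, Fin (k ℓ) → Fin (ℓ.1 : ℕ) → GL (Fin d) F)
    (x : U) : GL (Fin d) F :=
  M (u.symm x).1 (u.symm x).2.1 (u.symm x).2.2

/-- `ω_x` is `w_{ℓ,i}` if `x = u_{ℓ,i,ℓ-1}`, and `0` if `x = u_{ℓ,i,j}` with `j < ℓ - 1`. -/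
def omega (u : CycleIndex k ≃ U) (w : ∀ ℓ : Len N, Fin (k ℓ) → Fin d → F) (x : U) : Fin d → F :=
  if ((u.symm x).2.2 : ℕ) + 1 < ((u.symm x).1.1 : ℕ) then 0 else w (u.symm x).1 (u.symm x).2.1

/-- `ν_x` is `u_{ℓ,i,(j+1) mod ℓ} - x`, where `x = u_{ℓ,i,j}`. -/
def nu (u : CycleIndex k ≃ U) (x : U) : U :=
  u (u.symm x).next - x

/-- The map `(y, x) ↦ (y α_x + ω_x, x + ν_x)` on `F ^ d ⊕ U`. -/
def explicitMap (u : CycleIndex k ≃ U)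
    (M : ∀ ℓ : Len N, Fin (k ℓ) → Fin (ℓ.1 : ℕ) → GL (Fin d) F)
    (w : ∀ ℓ : Len N, Fin (k ℓ) → Fin d → F) (z : (Fin d → F) × U) : (Fin d → F) × U :=
  (z.1 ᵥ* (alpha u M z.2 : Matrix (Fin d) (Fin d) F) + omega u w z.2, z.2 + nu u z.2)

end Explicit

end

end CompleteMappings

/-!
A map `f (y, x) = (h x y, g x)` on `F_p ^ d × F_p ^ t` lying over a permutation `g` decomposes along
the cycles of `g`: on the part over a cycle of length `ℓ`, the `ℓ`-th iterate of `f` acts on one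
fibre by a return map `τ`, and the period of a point of this fibre under `f` is `ℓ` times its period
under `τ`. Hence the cycles of `f` over that cycle are those of `τ` blown up by the factor `ℓ`
(`cycleWeight_extension`). To compare cycle types without listing cycles, the exponent vector of
`CT σ` is written as a sum over points, a point on an `n`-cycle contributing `1 / n`
(`cycleWeight`); this sum splits along fibres and is invariant under conjugation. For the explicit
map, `τ` is the affine permutation with matrix `M₀ * ⋯ * M_{ℓ-1}` and translation `w`
(`explicitMap_iterate_len`). The map is a complete mapping because `g` is one and because
`y ↦ y α + y` is injective exactly when `α` does not have the eigenvalue `-1`.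

It remains to write an invertible matrix `T` as a product of `ℓ ≥ 2` matrices without eigenvalue
`-1`. Two factors suffice, and these exist as soon as there is `A` with `A`, `A - 1` and `A - T`
all invertible (a separator of `T`), since then `T = (-A) * (-A⁻¹ * T)`. Identify `F_p ^ d` with the
field `K` of `p ^ d` elements and take for `A` the multiplication by some `a` in `K` that is neither
`0` nor `1` nor a quotient `T v / v`. For odd `p` the vectors `v` and `-v` give the same quotient,
so at most half of the nonzero elements are quotients, and `a` exists unless `p ^ d = 3`.
For `p = 2` and `T` without nonzero fixed vector, `A = T ^ 2` is a separator; otherwise `1` is itself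
a quotient and one coincidence `T v / v = T w / w` leaves room for `a`. Two fixed vectors give such a
coincidence; if there is only one, then for `d ≥ 3` there is `v` with `v, T v, T ^ 2 v` linearly
independent, and the identification with `K` can be chosen to send these to `1, x, x ^ 2`. The cases
`p ^ d = 3` and `p ^ d = 4` are settled by hand, and for `p ^ d = 2` and `ℓ ≥ 2` there is no cycle
type to realize.
-/

namespace CompleteMappings

open Matrix MvPolynomial

noncomputable section

/-! ### Separators from field multiplications -/

section Separator

variable {F V : Type*} [Field F] [AddCommGroup V] [Module F V]

/-- `T` has a separator if some endomorphism `A` is pointwise different from each of `0`, `1` and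
`T` away from the origin; in finite dimension: `A`, `A - 1` and `A - T` are all invertible. -/
def HasSeparator (T : Module.End F V) : Prop :=
  ∃ A : Module.End F V, ∀ v, v ≠ 0 → A v ≠ 0 ∧ A v ≠ v ∧ A v ≠ T v

/-- Multiplication by a suitable field element is a separator, once `V` is identified with a
field extension of `F`. -/
theorem hasSeparator_of_field {K : Type*} [Field K] [Algebra F K] (φ : V ≃ₗ[F] K)
    (T : Module.End F V) (a : K) (h0 : a ≠ 0) (h1 : a ≠ 1)
    (hT : ∀ v, v ≠ 0 → φ (T v) / φ v ≠ a) : HasSeparator T := by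
  refine ⟨φ.symm.toLinearMap ∘ₗ LinearMap.mulLeft F a ∘ₗ φ.toLinearMap, fun v hv => ?_⟩
  have hφ : φ v ≠ 0 := fun h => hv (φ.map_eq_zero_iff.1 h)
  simp only [LinearMap.comp_apply, LinearEquiv.coe_coe, LinearMap.mulLeft_apply, ne_eq,
    LinearEquiv.symm_apply_eq, map_zero]
  refine ⟨mul_ne_zero h0 hφ, fun h => h1 ?_, fun h => hT v hv ?_⟩
  · exact mul_right_cancel₀ hφ (by rw [h, one_mul])
  · rw [← h, mul_div_cancel_right₀ _ hφ]

/-- Over a field of characteristic other than two, the quotient `T v / v` is invariant under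
`v ↦ -v`, so it takes at most half of the nonzero values. -/
theorem hasSeparator_of_neg_ne {K : Type*} [Field K] [Finite K] [Algebra F K] (φ : V ≃ₗ[F] K)
    (h2 : (2 : K) ≠ 0) (hK : 3 < Nat.card K) (T : Module.End F V) : HasSeparator T := by
  classical
  have := Fintype.ofFinite K
  set s : Finset K := Finset.univ.erase 0 with hs
  have hcs : s.card + 1 = Nat.card K := by
    rw [hs, Finset.card_erase_add_one (Finset.mem_univ _), Finset.card_univ,
      Nat.card_eq_fintype_card]
  let q : K → K := fun x => φ (T (φ.symm x)) / x
  have himg : 2 * (s.image q).card ≤ s.card := by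
    refine Finset.mul_card_image_le_card s 2 fun b hb => ?_
    obtain ⟨x, hx, rfl⟩ := Finset.mem_image.1 hb
    have hx0 : x ≠ 0 := by simpa [hs] using hx
    have hne : x ≠ -x := fun h => by
      have : (2 : K) * x = 0 := by linear_combination h
      exact (mul_ne_zero h2 hx0) this
    rw [← Finset.card_pair hne]
    refine Finset.card_le_card fun y hy => ?_
    simp only [Finset.mem_insert, Finset.mem_singleton] at hy
    rcases hy with rfl | rfl
    · simp [hx]
    · simp [hs, hx0, q]
  -- `2 + (|K| - 1) / 2 < |K|` because `|K| > 3`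
  obtain ⟨a, ha⟩ : ∃ a : K, a ∉ insert 0 (insert 1 (s.image q)) := by
    by_contra! h
    have h3 : (insert 0 (insert 1 (s.image q))).card = Nat.card K := by
      rw [Finset.eq_univ_of_forall h, Finset.card_univ, Nat.card_eq_fintype_card]
    have h4 := Finset.card_insert_le (0 : K) (insert 1 (s.image q))
    have h5 := Finset.card_insert_le (1 : K) (s.image q)
    omega
  simp only [Finset.mem_insert, not_or] at ha
  refine hasSeparator_of_field φ T a ha.1 ha.2.1 fun v hv h => ha.2.2 ?_
  refine Finset.mem_image.2 ⟨φ v, ?_, ?_⟩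
  · simpa [hs] using hv
  · simpa [q] using h

/-- If `T` has a nonzero fixed vector, then `1` is among the quotients `T v / v`; hence one
coincidence between these quotients suffices. -/
theorem hasSeparator_of_collision {K : Type*} [Field K] [Finite K] [Algebra F K] (φ : V ≃ₗ[F] K)
    (T : Module.End F V) (hT : ∀ v, T v = 0 → v = 0) (e : V) (he : e ≠ 0) (hTe : T e = e)
    (v w : V) (hv : v ≠ 0) (hw : w ≠ 0) (hvw : v ≠ w)
    (h : φ (T v) / φ v = φ (T w) / φ w) : HasSeparator T := by
  have hne : ∀ x : V, x ≠ 0 → φ x ≠ 0 := fun x hx h => hx (φ.map_eq_zero_iff.1 h)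
  have hne' : ∀ x : {x : K // x ≠ 0}, φ.symm x ≠ 0 := fun x hx =>
    x.2 (φ.symm.map_eq_zero_iff.1 hx)
  let q : {x : K // x ≠ 0} → {x : K // x ≠ 0} := fun x =>
    ⟨φ (T (φ.symm x)) / x, div_ne_zero (hne _ fun h => hne' x (hT _ h)) x.2⟩
  have hq : ¬ Function.Surjective q := by
    rw [← Finite.injective_iff_surjective]
    intro hinj
    have := @hinj ⟨φ v, hne v hv⟩ ⟨φ w, hne w hw⟩ (by simpa [q] using h)
    exact hvw (by simpa using this)
  obtain ⟨⟨a, ha0⟩, ha⟩ := not_forall.1 hq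
  have ha' : ∀ x, x ≠ 0 → φ (T x) / φ x ≠ a := fun x hx h =>
    ha ⟨⟨φ x, hne x hx⟩, by simpa [q] using h⟩
  refine hasSeparator_of_field φ T a ha0 (fun h1 => ?_) ha'
  refine ha' e he ?_
  rw [hTe, h1, div_self (hne e he)]

/-- In characteristic two, `T ^ 2` separates an invertible `T` without nonzero fixed vectors. -/
theorem hasSeparator_of_no_fixed [CharP F 2] (T : Module.End F V) (hT : ∀ v, T v = 0 → v = 0)
    (h1 : ∀ v, T v = v → v = 0) : HasSeparator T := by
  have hself : ∀ x : V, x + x = 0 := fun x => by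
    have h2 : (1 + 1 : F) = 0 := by rw [one_add_one_eq_two]; exact CharTwo.two_eq_zero
    rw [← one_smul F x, ← add_smul, h2, zero_smul]
  refine ⟨T * T, fun v hv => ⟨fun h => hv (hT _ (hT _ h)), fun h => hv ?_, fun h => hv ?_⟩⟩
  · have h3 : T (T v + v) = T v + v := by
      rw [map_add, add_comm]; exact congrArg _ h
    have h4 : T v = -v := eq_neg_of_add_eq_zero_left (h1 _ h3)
    rw [← eq_neg_of_add_eq_zero_left (hself v)] at h4
    exact h1 v h4
  · exact hT _ (h1 _ h)

end Separator

section Transport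

variable {F V K : Type*} [Field F] [AddCommGroup V] [Module F V] [AddCommGroup K] [Module F K]

/-- Linearly independent families in spaces of equal finite dimension correspond under a
suitable isomorphism. -/
theorem exists_linearEquiv_apply_eq [FiniteDimensional F V] [FiniteDimensional F K] {ι : Type*}
    (h : Module.finrank F V = Module.finrank F K) {x : ι → V} {y : ι → K}
    (hx : LinearIndependent F x) (hy : LinearIndependent F y) :
    ∃ φ : V ≃ₗ[F] K, ∀ i, φ (x i) = y i := by
  let ψ : V ≃ₗ[F] K := LinearEquiv.ofFinrankEq V K h
  have hx' : LinearIndependent F (ψ ∘ x) := hx.map' ψ.toLinearMap ψ.ker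
  let f := hx'.linearCombinationEquiv.symm ≪≫ₗ hy.linearCombinationEquiv
  obtain ⟨g, hg⟩ := Submodule.exists_linearEquiv_restrict_eq f
  refine ⟨ψ ≪≫ₗ g, fun i => ?_⟩
  have h1 : (hx'.linearCombinationEquiv (Finsupp.single i 1) : K) = ψ (x i) := by simp
  rw [LinearEquiv.trans_apply, ← h1, ← hg]
  simp [f]

end Transport

/-! ### Separators in characteristic two and over prime fields -/

section CharTwo

variable {V : Type*} [AddCommGroup V] [Module (ZMod 2) V]

/-- If `T e = e` and `T ^ 2 v ≠ v`, then `v` or `v + e` generates a cyclic subspace of dimension at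
least three: the only possible relation of lower degree is `w + T w + T ^ 2 w = 0`, and it cannot
hold for both. -/
theorem exists_linearIndependent_orbit (T : Module.End (ZMod 2) V) (hT : ∀ v, T v = 0 → v = 0)
    (e : V) (he : e ≠ 0) (hTe : T e = e) (v : V) (hv : T (T v) ≠ v) :
    ∃ w, LinearIndependent (ZMod 2) ![w, T w, T (T w)] := by
  have hz : ∀ a : ZMod 2, a = 0 ∨ a = 1 := by decide
  have hself : ∀ x : V, x + x = 0 := fun x => by
    have h2 : (1 + 1 : ZMod 2) = 0 := by decide
    rw [← one_smul (ZMod 2) x, ← add_smul, h2, zero_smul]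
  have hneg : ∀ x : V, -x = x := fun x => neg_eq_of_add_eq_zero_left (hself x)
  have key : ∀ w, T (T w) ≠ w → ¬ LinearIndependent (ZMod 2) ![w, T w, T (T w)] →
      w + T w + T (T w) = 0 := by
    intro w hw hli
    rw [Fintype.not_linearIndependent_iff] at hli
    obtain ⟨c, hc, i, hi⟩ := hli
    -- the seven nonzero relations over the field with two elements
    simp only [Fin.sum_univ_three, Matrix.cons_val_zero, Matrix.cons_val_one,
      Matrix.cons_val] at hc
    have hinj : ∀ x y, T x = T y → x = y := fun x y h =>
      sub_eq_zero.1 (hT _ (by rw [map_sub, h, sub_self]))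
    have hw0 : w ≠ 0 := fun h => hw (by simp [h])
    have hw1 : T w ≠ w := fun h => hw (by rw [h, h])
    rcases hz (c 0) with h0 | h0 <;> rcases hz (c 1) with h1 | h1 <;>
      rcases hz (c 2) with h2 | h2 <;> simp only [h0, h1, h2, zero_smul, one_smul, zero_add,
        add_zero] at hc
    · fin_cases i <;> simp_all
    · exact absurd (hT _ (hT _ hc)) hw0
    · exact absurd (hT _ hc) hw0
    · rw [add_eq_zero_iff_eq_neg, hneg] at hc
      exact absurd (hinj _ _ hc).symm hw1
    · exact absurd hc hw0
    · rw [add_eq_zero_iff_eq_neg, hneg] at hc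
      exact absurd hc.symm hw
    · rw [add_eq_zero_iff_eq_neg, hneg] at hc
      exact absurd hc.symm hw1
    · exact hc
  by_contra! hcon
  have e1 := key v hv (hcon v)
  have e2 := key (v + e) (by simpa [hTe] using hv) (hcon _)
  simp only [map_add, hTe] at e2
  refine he ?_
  have : v + e + (T v + e) + (T (T v) + e) = (v + T v + T (T v)) + (e + e) + e := by abel
  rw [this, e1, hself, zero_add, zero_add] at e2
  exact e2

end CharTwo

/-- The three powers `1, x, x ^ 2` of a generator of a finite field extension of degree at least
three are linearly independent. -/
theorem exists_linearIndependent_powers (F K : Type*) [Field F] [Field K] [Algebra F K] [Finite K]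
    [FiniteDimensional F K] [Algebra.IsSeparable F K] (h : 3 ≤ Module.finrank F K) :
    ∃ x : K, LinearIndependent F ![1, x, x * x] := by
  let pb := Field.powerBasisOfFiniteOfSeparable F K
  have hd : 3 ≤ pb.dim := by rw [← pb.finrank]; exact h
  refine ⟨pb.gen, ?_⟩
  have hpow : ![1, pb.gen, pb.gen * pb.gen] = pb.basis ∘ Fin.castLE hd := by
    ext i
    fin_cases i <;> simp [pow_two]
  rw [hpow]
  exact pb.basis.linearIndependent.comp (Fin.castLE hd) (Fin.castLE_injective hd)

section PrimeField

variable {V : Type*} [AddCommGroup V]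

/-- Over the field with two elements, the argument splits according to whether the fixed space of
`T` has dimension zero, one, or at least two. -/
theorem hasSeparator_of_two [Module (ZMod 2) V] [FiniteDimensional (ZMod 2) V]
    (hd : 3 ≤ Module.finrank (ZMod 2) V) (T : Module.End (ZMod 2) V)
    (hT : ∀ v, T v = 0 → v = 0) : HasSeparator T := by
  by_cases hfix : ∀ v, T v = v → v = 0
  · exact hasSeparator_of_no_fixed T hT hfix
  push Not at hfix
  obtain ⟨e, hTe, he⟩ := hfix
  have hd0 : Module.finrank (ZMod 2) V ≠ 0 := by omega
  let K := GaloisField 2 (Module.finrank (ZMod 2) V)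
  have hK : Module.finrank (ZMod 2) K = Module.finrank (ZMod 2) V := GaloisField.finrank 2 hd0
  by_cases huniq : ∀ e', T e' = e' → e' ≠ 0 → e' = e
  · have hex : ∃ v, T (T v) ≠ v := by
      by_contra! hall
      -- `(T + 1) ^ 2 = T ^ 2 + 1 = 0`, so the rank of `T + 1` is at most its nullity, which is one
      have hself : ∀ x : V, x + x = 0 := fun x => by
        have h2 : (1 + 1 : ZMod 2) = 0 := by decide
        rw [← one_smul (ZMod 2) x, ← add_smul, h2, zero_smul]
      have hN := LinearMap.finrank_range_add_finrank_ker (T + 1)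
      have hle : LinearMap.range (T + 1) ≤ LinearMap.ker (T + 1) := by
        rintro _ ⟨v, rfl⟩
        rw [LinearMap.mem_ker]
        simp only [LinearMap.add_apply, Module.End.one_apply, map_add, hall]
        rw [add_comm v, hself]
      have hle' := Submodule.finrank_mono hle
      have hker : Module.finrank (ZMod 2) (LinearMap.ker (T + 1)) ≤ 1 := by
        refine (Submodule.finrank_mono (t := Submodule.span (ZMod 2) {e}) ?_).trans
          (finrank_span_singleton he).le
        intro x hx
        rw [LinearMap.mem_ker, LinearMap.add_apply, Module.End.one_apply] at hx
        by_cases hx0 : x = 0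
        · rw [hx0]; exact zero_mem _
        · have : T x = x := by
            rw [eq_neg_of_add_eq_zero_left hx, neg_eq_of_add_eq_zero_left (hself x)]
          rw [huniq x this hx0]
          exact Submodule.mem_span_singleton_self e
      omega
    obtain ⟨v, hv⟩ := hex
    obtain ⟨w, hw⟩ := exists_linearIndependent_orbit T hT e he hTe v hv
    obtain ⟨x, hx⟩ := exists_linearIndependent_powers (ZMod 2) K (hd.trans hK.ge)
    obtain ⟨φ, hφ⟩ := exists_linearEquiv_apply_eq hK.symm hw hx
    have h0 : φ w = 1 := hφ 0
    have h1 : φ (T w) = x := hφ 1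
    have h2 : φ (T (T w)) = x * x := hφ 2
    have hx0 : x ≠ 0 := hx.ne_zero 1
    refine hasSeparator_of_collision φ T hT e he hTe w (T w) (hw.ne_zero 0) (hw.ne_zero 1)
      (fun h => ?_) ?_
    · have := hw.injective (show ![w, T w, T (T w)] 0 = ![w, T w, T (T w)] 1 from h)
      simp at this
    · rw [h0, h1, h2, div_one, mul_div_cancel_right₀ _ hx0]
  · push Not at huniq
    obtain ⟨e', hTe', he', hne⟩ := huniq
    let φ : V ≃ₗ[ZMod 2] K := LinearEquiv.ofFinrankEq V K hK.symm
    refine hasSeparator_of_collision φ T hT e he hTe e' e he' he hne ?_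
    rw [hTe, hTe', div_self, div_self] <;> simpa

/-- Apart from three small cases, every invertible endomorphism of a nonzero finite vector space
over a prime field has a separator. -/
theorem hasSeparator_of_prime {p : ℕ} [Fact p.Prime] [Module (ZMod p) V]
    [FiniteDimensional (ZMod p) V] {d : ℕ} (hd : 0 < d) (hV : Module.finrank (ZMod p) V = d)
    (h1 : (d, p) ≠ (1, 2)) (h2 : (d, p) ≠ (1, 3)) (h3 : (d, p) ≠ (2, 2))
    (T : Module.End (ZMod p) V) (hT : ∀ v, T v = 0 → v = 0) : HasSeparator T := by
  have hp := (Fact.out : p.Prime)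
  rcases hp.eq_two_or_odd' with rfl | hodd
  · refine hasSeparator_of_two ?_ T hT
    rw [hV]
    by_contra hlt
    interval_cases d <;> simp_all
  · have hK : Module.finrank (ZMod p) (GaloisField p d) = d := GaloisField.finrank p hd.ne'
    have hp3 : 3 ≤ p := by
      have := hp.two_le
      rcases hodd with ⟨m, rfl⟩
      omega
    refine hasSeparator_of_neg_ne (K := GaloisField p d)
      (LinearEquiv.ofFinrankEq V _ (hV.trans hK.symm)) ?_ ?_ T
    · intro h
      have : ((2 : ℕ) : GaloisField p d) = 0 := by exact_mod_cast h
      rw [CharP.cast_eq_zero_iff (GaloisField p d) p] at this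
      have := Nat.le_of_dvd two_pos this
      omega
    · rw [GaloisField.card p d hd.ne']
      rcases Nat.lt_or_ge 1 d with hd1 | hd1
      · calc 3 < 3 ^ 2 := by norm_num
          _ ≤ p ^ 2 := Nat.pow_le_pow_left hp3 2
          _ ≤ p ^ d := Nat.pow_le_pow_right (by omega) hd1
      · obtain rfl : d = 1 := by omega
        rw [pow_one]
        have : p ≠ 3 := by rintro rfl; exact h2 rfl
        omega

end PrimeField

/-! ### Products of matrices without eigenvalue `-1` -/

section Factorization

variable {F : Type*} [Field F] {d : ℕ}

theorem mem_CGL_iff {A : GL (Fin d) F} :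
    A ∈ CGL d F ↔ ∀ x, x ᵥ* (A : Matrix (Fin d) (Fin d) F) = -x → x = 0 := by
  simp only [CGL, Set.mem_ofPred_eq, Module.End.hasEigenvalue_iff, Submodule.eq_bot_iff, not_not,
    Module.End.mem_eigenspace_iff, vecMulLinear_apply, neg_smul, one_smul]

/-- A separator `A` of `M` yields the factorization `M = (-A) * (-A⁻¹ * M)` into matrices without
eigenvalue `-1`. -/
theorem exists_mul_of_hasSeparator (M : GL (Fin d) F)
    (h : HasSeparator (vecMulLinear (M : Matrix (Fin d) (Fin d) F))) :
    ∃ A ∈ CGL d F, ∃ B ∈ CGL d F, A * B = M := by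
  obtain ⟨f, hf⟩ := h
  obtain ⟨C, rfl⟩ : ∃ C : Matrix (Fin d) (Fin d) F, vecMulLinear C = f :=
    ⟨LinearMap.toMatrixRight' f, LinearMap.toMatrixRight'.symm_apply_apply f⟩
  simp only [vecMulLinear_apply] at hf
  have hC : IsUnit C := by
    rw [← vecMul_injective_iff_isUnit, ← coe_vecMulLinear, injective_iff_map_eq_zero]
    intro v hv
    by_contra hne
    exact (hf v hne).1 hv
  obtain ⟨U, rfl⟩ := hC
  refine ⟨-U, mem_CGL_iff.2 fun x hx => ?_, (-U)⁻¹ * M, mem_CGL_iff.2 fun x hx => ?_,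
    mul_inv_cancel_left _ _⟩
  · by_contra hne
    rw [Units.val_neg, vecMul_neg, neg_inj] at hx
    exact (hf x hne).2.1 hx
  · set y := x ᵥ* ((-U)⁻¹ : GL (Fin d) F).1 with hy
    have hxy : x = y ᵥ* (-U : GL (Fin d) F).1 := by
      rw [hy, vecMul_vecMul, ← Units.val_mul, inv_mul_cancel, Units.val_one, vecMul_one]
    rw [Units.val_mul, ← vecMul_vecMul, ← hy, hxy, Units.val_neg, vecMul_neg, neg_neg] at hx
    by_contra hne
    have hy0 : y ≠ 0 := fun h => hne (by rw [hxy, h, zero_vecMul])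
    exact (hf y hy0).2.2 hx.symm

/-- If every element of `S` is a product of two elements of `CGL d F`, the second one again in
`S`, then every element of `S` is a product of any number `n + 2` of elements of `CGL d F`. -/
theorem exists_prod_of_forall_exists_mul (S : Set (GL (Fin d) F))
    (h : ∀ M ∈ S, ∃ A ∈ CGL d F, ∃ B ∈ CGL d F, B ∈ S ∧ A * B = M) (n : ℕ) :
    ∀ M ∈ S, ∃ A : Fin (n + 2) → GL (Fin d) F,
      (∀ j, A j ∈ CGL d F) ∧ (List.ofFn A).prod = M := by
  induction n with
  | zero =>
    intro M hM
    obtain ⟨A, hA, B, hB, -, rfl⟩ := h M hM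
    refine ⟨![A, B], fun j => ?_, by simp [List.ofFn_succ]⟩
    fin_cases j <;> assumption
  | succ n ih =>
    intro M hM
    obtain ⟨A, hA, B, -, hBS, rfl⟩ := h M hM
    obtain ⟨C, hC, rfl⟩ := ih B hBS
    refine ⟨Fin.cons A C, fun j => ?_, by simp [List.ofFn_succ]⟩
    refine Fin.cases ?_ (fun i => ?_) j
    · simpa using hA
    · simpa using hC i

end Factorization

/-! ### Cycle types as sums over points -/

section CycleWeight

open Function

variable {Ω Ω' : Type*}

theorem minimalPeriod_perm_pos [Finite Ω] (σ : Equiv.Perm Ω) (x : Ω) : 0 < minimalPeriod σ x :=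
  minimalPeriod_pos_of_mem_periodicPts (σ.injective.mem_periodicPts x)

/-- The length of the cycle of `σ` through `x`, as a positive integer. -/
def period [Finite Ω] (σ : Equiv.Perm Ω) (x : Ω) : ℕ+ :=
  ⟨minimalPeriod σ x, minimalPeriod_perm_pos σ x⟩

theorem sameCycle_iff_exists_iterate [Finite Ω] (σ : Equiv.Perm Ω) {x y : Ω} :
    σ.SameCycle x y ↔ ∃ j < minimalPeriod σ x, σ^[j] x = y := by
  constructor
  · intro h
    obtain ⟨n, rfl⟩ := h.exists_nat_pow_eq
    refine ⟨n % minimalPeriod σ x, Nat.mod_lt _ (minimalPeriod_perm_pos σ x), ?_⟩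
    rw [iterate_mod_minimalPeriod_eq, Equiv.Perm.iterate_eq_pow]
  · rintro ⟨j, -, rfl⟩
    rw [Equiv.Perm.iterate_eq_pow]
    exact Equiv.Perm.sameCycle_pow_right.2 (Equiv.Perm.SameCycle.refl σ x)

theorem ncard_sameCycle [Finite Ω] (σ : Equiv.Perm Ω) (x : Ω) :
    {y | σ.SameCycle x y}.ncard = minimalPeriod σ x := by
  have h : {y | σ.SameCycle x y} = (σ^[·] x) '' Set.Iio (minimalPeriod σ x) := by
    ext y
    simp [sameCycle_iff_exists_iterate]
  rw [h, iterate_injOn_Iio_minimalPeriod.ncard_image, ← Finset.coe_Iio,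
    Set.ncard_coe_finset, Nat.card_Iio]

theorem sameCycle_class_eq_iff (σ : Equiv.Perm Ω) {x y : Ω} :
    {z | σ.SameCycle x z} = {z | σ.SameCycle y z} ↔ σ.SameCycle x y := by
  constructor
  · intro h
    have : y ∈ {z | σ.SameCycle y z} := Equiv.Perm.SameCycle.refl σ y
    rw [← h] at this
    exact this
  · intro h
    ext z
    exact ⟨fun hz => h.symm.trans hz, fun hz => h.trans hz⟩

theorem SameCycle.minimalPeriod_eq [Finite Ω] {σ : Equiv.Perm Ω} {x y : Ω}
    (h : σ.SameCycle x y) : minimalPeriod σ x = minimalPeriod σ y := by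
  rw [← ncard_sameCycle, ← ncard_sameCycle, (sameCycle_class_eq_iff σ).2 h]

/-- The cycles of length `ℓ` partition the points of period `ℓ` into sets of size `ℓ`. -/
theorem cycleCount_mul [Fintype Ω] (σ : Equiv.Perm Ω) (ℓ : ℕ) :
    cycleCount σ ℓ * ℓ = (Finset.univ.filter fun x => minimalPeriod σ x = ℓ).card := by
  classical
  set S : Set (Set Ω) := {c | (∃ x, c = {y | σ.SameCycle x y}) ∧ c.ncard = ℓ}
  have hmaps : ∀ x ∈ Finset.univ.filter fun x => minimalPeriod σ x = ℓ,
      {y | σ.SameCycle x y} ∈ S.toFinite.toFinset := by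
    intro x hx
    rw [Set.Finite.mem_toFinset]
    exact ⟨⟨x, rfl⟩, by rw [ncard_sameCycle]; simpa using hx⟩
  rw [Finset.card_eq_sum_card_fiberwise hmaps, Finset.sum_const_nat (m := ℓ)]
  · rw [cycleCount, Set.ncard_eq_toFinset_card]
  · intro c hc
    rw [Set.Finite.mem_toFinset] at hc
    obtain ⟨⟨x, rfl⟩, hx⟩ := hc
    rw [← hx, ← Set.ncard_coe_finset]
    congr 1
    ext y
    rw [ncard_sameCycle]
    simp only [Finset.coe_filter, Finset.mem_filter, Finset.mem_univ, true_and,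
      sameCycle_class_eq_iff, Set.mem_ofPred_eq]
    exact ⟨fun h => h.2.symm, fun h => ⟨(SameCycle.minimalPeriod_eq h).symm, h.symm⟩⟩

/-- The function `n ↦ number of cycles of length n`, written as a sum over points: a point on a
cycle of length `n` contributes `1 / n`. -/
def cycleWeight [Fintype Ω] (σ : Equiv.Perm Ω) : ℕ+ →₀ ℚ :=
  ∑ x, Finsupp.single (period σ x) ((period σ x : ℕ) : ℚ)⁻¹

theorem cycleWeight_apply [Fintype Ω] (σ : Equiv.Perm Ω) (n : ℕ+) :
    cycleWeight σ n = cycleCount σ n := by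
  have h1 : ∀ x, (Finsupp.single (period σ x) ((period σ x : ℕ) : ℚ)⁻¹) n =
      if minimalPeriod σ x = n then ((n : ℕ) : ℚ)⁻¹ else 0 := by
    intro x
    have hiff : period σ x = n ↔ minimalPeriod σ x = n := by
      rw [← PNat.coe_inj]; rfl
    by_cases h : period σ x = n
    · rw [if_pos (hiff.1 h), h, Finsupp.single_eq_same]
    · rw [if_neg (mt hiff.2 h), Finsupp.single_eq_of_ne' h]
  have hn : ((n : ℕ) : ℚ) ≠ 0 := by exact_mod_cast n.ne_zero
  rw [cycleWeight, Finsupp.finsetSum_apply, Finset.sum_congr rfl fun x _ => h1 x,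
    ← Finset.sum_filter, Finset.sum_const, ← cycleCount_mul, nsmul_eq_mul, Nat.cast_mul,
    mul_inv_cancel_right₀ hn]

theorem cycleCount_eq_zero [Finite Ω] (σ : Equiv.Perm Ω) {n : ℕ} (hn : Nat.card Ω < n) :
    cycleCount σ n = 0 := by
  have := Fintype.ofFinite Ω
  have h := cycleCount_mul σ n
  rw [Finset.filter_false_of_mem, Finset.card_empty] at h
  · rcases Nat.mul_eq_zero.1 h with h | h
    · exact h
    · omega
  · intro x _ hx
    rw [← ncard_sameCycle] at hx
    have := Set.ncard_le_card {y | σ.SameCycle x y}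
    omega

/-- The exponent vector of the monomial `CT σ`. -/
def cycleExponent [Finite Ω] (σ : Equiv.Perm Ω) : ℕ+ →₀ ℕ :=
  ∑ ℓ : Len (Nat.card Ω), Finsupp.single ℓ.1 (cycleCount σ ℓ.1)

theorem sum_single_len_apply {N : ℕ} (k : Len N → ℕ) (ℓ : Len N) :
    (∑ m : Len N, Finsupp.single m.1 (k m)) ℓ.1 = k ℓ := by
  rw [Finsupp.finsetSum_apply, Finset.sum_eq_single ℓ, Finsupp.single_eq_same]
  · intro m _ hm
    exact Finsupp.single_eq_of_ne' fun h => hm (Subtype.ext h)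
  · exact fun h => absurd (Finset.mem_univ ℓ) h

theorem cycleExponent_apply [Finite Ω] (σ : Equiv.Perm Ω) (n : ℕ+) :
    cycleExponent σ n = cycleCount σ n := by
  by_cases hn : (n : ℕ) ≤ Nat.card Ω
  · exact sum_single_len_apply (fun ℓ => cycleCount σ ℓ.1) ⟨n, hn⟩
  · rw [cycleCount_eq_zero σ (not_le.1 hn), cycleExponent, Finsupp.finsetSum_apply]
    refine Finset.sum_eq_zero fun m _ => Finsupp.single_eq_of_ne' ?_
    rintro rfl
    exact hn m.2

theorem prod_X_pow_len {N : ℕ} (k : Len N → ℕ) :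
    ∏ ℓ : Len N, (X ℓ.1 : MvPolynomial ℕ+ ℚ) ^ k ℓ =
      monomial (∑ ℓ : Len N, Finsupp.single ℓ.1 (k ℓ)) 1 := by
  simp_rw [X_pow_eq_monomial, monomial_sum_one]

theorem CT_eq_monomial [Finite Ω] (σ : Equiv.Perm Ω) : CT σ = monomial (cycleExponent σ) 1 :=
  prod_X_pow_len _

/-- Exponent vectors, regarded as rational vectors. -/
def castExponent : (ℕ+ →₀ ℕ) →+ (ℕ+ →₀ ℚ) :=
  Finsupp.mapRange.addMonoidHom (Nat.castAddMonoidHom ℚ)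

theorem castExponent_apply (m : ℕ+ →₀ ℕ) (n : ℕ+) : castExponent m n = m n := by
  simp [castExponent]

theorem castExponent_injective : Injective castExponent := by
  intro a b h
  ext n
  have := DFunLike.congr_fun h n
  rwa [castExponent_apply, castExponent_apply, Nat.cast_inj] at this

theorem castExponent_mapDomain (q : ℕ+ → ℕ+) (m : ℕ+ →₀ ℕ) :
    castExponent (m.mapDomain q) = (castExponent m).mapDomain q :=
  (Finsupp.mapDomain_mapRange q m _ (by simp) (by simp)).symm

theorem castExponent_cycleExponent [Fintype Ω] (σ : Equiv.Perm Ω) :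
    castExponent (cycleExponent σ) = cycleWeight σ := by
  ext n
  rw [castExponent_apply, cycleExponent_apply, cycleWeight_apply]

theorem CT_eq_monomial_of_cycleWeight [Fintype Ω] {σ : Equiv.Perm Ω} {m : ℕ+ →₀ ℕ}
    (h : cycleWeight σ = castExponent m) : CT σ = monomial m 1 := by
  rw [CT_eq_monomial, castExponent_injective ((castExponent_cycleExponent σ).trans h)]

/-- A multiplicative relation between cycle types follows from the additive relation between
cycle weights. -/
theorem CT_eq_prod_of_cycleWeight [Fintype Ω] [Fintype Ω'] {ι : Type*} {κ : ι → Type*} [Fintype ι]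
    [∀ i, Fintype (κ i)] (σ : Equiv.Perm Ω) (n : ι → ℕ+) (τ : ∀ i, κ i → Equiv.Perm Ω')
    (h : cycleWeight σ = ∑ i, ∑ j, (cycleWeight (τ i j)).mapDomain (n i * ·)) :
    CT σ = ∏ i, ∏ j, BU (n i) (CT (τ i j)) := by
  have h1 : ∀ i j, BU (n i) (CT (τ i j)) =
      monomial ((cycleExponent (τ i j)).mapDomain (n i * ·)) 1 := fun i j => by
    rw [BU, CT_eq_monomial, rename_monomial]
  simp_rw [h1, ← monomial_sum_one]
  apply CT_eq_monomial_of_cycleWeight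
  simp_rw [h, map_sum, castExponent_mapDomain, castExponent_cycleExponent]

theorem period_of_semiconj [Finite Ω] [Finite Ω'] (e : Ω ≃ Ω') {σ : Equiv.Perm Ω}
    {σ' : Equiv.Perm Ω'} (h : ∀ z, σ' (e z) = e (σ z)) (z : Ω) : period σ' (e z) = period σ z := by
  have hs : Semiconj e σ σ' := fun x => (h x).symm
  apply PNat.eq
  change minimalPeriod σ' (e z) = minimalPeriod σ z
  rw [minimalPeriod_eq_minimalPeriod_iff]
  intro n
  rw [IsPeriodicPt, IsFixedPt, ← (hs.iterate_right n).eq, e.apply_eq_iff_eq]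
  rfl

theorem cycleWeight_of_semiconj [Fintype Ω] [Fintype Ω'] (e : Ω ≃ Ω') {σ : Equiv.Perm Ω}
    {σ' : Equiv.Perm Ω'} (h : ∀ z, σ' (e z) = e (σ z)) : cycleWeight σ' = cycleWeight σ := by
  rw [cycleWeight, ← e.sum_comp]
  simp_rw [period_of_semiconj e h]
  rfl

end CycleWeight

/-! ### Cycles of an extension, and enumerations of cycles -/

section Extension

open Function

variable {Y U : Type*} {N : ℕ} {k : Len N → ℕ}

/-- The first element `u_{ℓ,i,0}` of the `i`-th cycle of length `ℓ`. -/
def CycleIndex.base {N : ℕ} {k : Len N → ℕ} (ℓ : Len N) (i : Fin (k ℓ)) : CycleIndex k :=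
  ⟨ℓ, i, ⟨0, ℓ.1.pos⟩⟩

theorem iterate_enumeration {g : U → U} {u : CycleIndex k ≃ U} (hu : ∀ c, g (u c) = u c.next)
    (ℓ : Len N) (i : Fin (k ℓ)) (n : ℕ) :
    g^[n] (u (CycleIndex.base ℓ i)) = u ⟨ℓ, i, ⟨n % ℓ.1, Nat.mod_lt _ ℓ.1.pos⟩⟩ := by
  induction n with
  | zero => simp [CycleIndex.base]
  | succ n ih =>
    rw [iterate_succ_apply', ih, hu]
    simp [CycleIndex.next]

theorem minimalPeriod_enumeration {g : U → U} {u : CycleIndex k ≃ U}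
    (hu : ∀ c, g (u c) = u c.next) (ℓ : Len N) (i : Fin (k ℓ)) :
    minimalPeriod g (u (CycleIndex.base ℓ i)) = ℓ.1 := by
  rw [← Nat.dvd_right_iff_eq]
  intro n
  rw [← isPeriodicPt_iff_minimalPeriod_dvd, IsPeriodicPt, IsFixedPt, iterate_enumeration hu,
    u.apply_eq_iff_eq, CycleIndex.base]
  simp [Nat.dvd_iff_mod_eq_zero]

/-- If `f` lies over `g` and the point `x` has period `n` under `g`, with return map `τ` on the
fibre of `x`, then the periods under `f` on this fibre are `n` times those under `τ`. -/
theorem minimalPeriod_fibre {f : Y × U → Y × U} {g : U → U} (hfg : ∀ z, (f z).2 = g z.2)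
    {x : U} {n : ℕ} (hx : minimalPeriod g x = n) {τ : Y → Y} (hτ : ∀ y, f^[n] (y, x) = (τ y, x))
    (y : Y) : minimalPeriod f (y, x) = n * minimalPeriod τ y := by
  have hs : Semiconj Prod.snd f g := hfg
  have hτ' : Semiconj (fun y => (y, x)) τ f^[n] := fun y => (hτ y).symm
  rw [← Nat.dvd_right_iff_eq]
  intro m
  rw [← isPeriodicPt_iff_minimalPeriod_dvd]
  have hiter : ∀ r, IsPeriodicPt f (n * r) (y, x) ↔ minimalPeriod τ y ∣ r := fun r => by
    rw [← isPeriodicPt_iff_minimalPeriod_dvd, IsPeriodicPt, IsFixedPt, iterate_mul,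
      ← (hτ'.iterate_right r).eq, Prod.mk.injEq]
    exact and_iff_left rfl
  constructor
  · intro h
    obtain ⟨r, rfl⟩ : n ∣ m := hx ▸ (h.map hs).minimalPeriod_dvd
    exact mul_dvd_mul_left n ((hiter r).1 h)
  · rintro ⟨r, rfl⟩
    rw [mul_assoc, hiter]
    exact dvd_mul_right _ _

/-- Cycle structure of an extension `f` of `g`: every cycle of length `ℓ` of `g`, with return map
`τ ℓ i`, contributes the cycles of `τ ℓ i`, blown up by the factor `ℓ`. -/
theorem cycleWeight_extension [Fintype Y] [Fintype U] {f : Equiv.Perm (Y × U)} {g : U → U}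
    {h : U → Equiv.Perm Y}
    (hf : ∀ y x, f (y, x) = (h x y, g x)) {u : CycleIndex k ≃ U}
    (hu : ∀ c, g (u c) = u c.next) (τ : ∀ ℓ : Len N, Fin (k ℓ) → Equiv.Perm Y)
    (hτ : ∀ ℓ i y, f^[ℓ.1] (y, u (CycleIndex.base ℓ i)) =
      (τ ℓ i y, u (CycleIndex.base ℓ i))) :
    cycleWeight f = ∑ ℓ : Len N, ∑ i, (cycleWeight (τ ℓ i)).mapDomain (ℓ.1 * ·) := by
  let S : U → ℕ+ →₀ ℚ := fun x =>
    ∑ y, Finsupp.single (period f (y, x)) ((period f (y, x) : ℕ) : ℚ)⁻¹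
  have hper : ∀ z, period f (f z) = period f z := fun z =>
    PNat.eq (minimalPeriod_apply (f.injective.mem_periodicPts z))
  -- the fibres over a cycle contribute equally, since `f` maps each to the next
  have hS : ∀ x, S (g x) = S x := fun x => by
    refine (Equiv.sum_comp (h x) _).symm.trans ?_
    exact Finset.sum_congr rfl fun y _ => by rw [← hf, hper]
  have hS' : ∀ n x, S (g^[n] x) = S x := by
    intro n
    induction n with
    | zero => exact fun x => rfl
    | succ n ih => exact fun x => by rw [iterate_succ_apply', hS, ih]
  have hbase : ∀ (ℓ : Len N) (i : Fin (k ℓ)),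
      (ℓ.1 : ℕ) • S (u (CycleIndex.base ℓ i)) = (cycleWeight (τ ℓ i)).mapDomain (ℓ.1 * ·) := by
    intro ℓ i
    have hp : ∀ y, period f (y, u (CycleIndex.base ℓ i)) = ℓ.1 * period (τ ℓ i) y := fun y =>
      PNat.eq (minimalPeriod_fibre (g := g) (fun z => by rw [← Prod.mk.eta (p := z), hf])
        (minimalPeriod_enumeration hu ℓ i) (hτ ℓ i) y)
    have hl : ((ℓ.1 : ℕ) : ℚ) ≠ 0 := by exact_mod_cast ℓ.1.ne_zero
    rw [cycleWeight, Finsupp.mapDomain_finsetSum, Finset.smul_sum]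
    refine Finset.sum_congr rfl fun y _ => ?_
    rw [hp, Finsupp.mapDomain_single, Finsupp.smul_single, PNat.mul_coe, Nat.cast_mul, mul_inv,
      nsmul_eq_mul, mul_inv_cancel_left₀ hl]
  calc cycleWeight f = ∑ x, S x := Fintype.sum_prod_type_right _
    _ = ∑ c, S (u c) := (u.sum_comp _).symm
    _ = ∑ ℓ : Len N, ∑ i, ∑ j, S (u ⟨ℓ, i, j⟩) := by
      rw [Fintype.sum_sigma]
      exact Finset.sum_congr rfl fun ℓ _ => Fintype.sum_prod_type _
    _ = ∑ ℓ : Len N, ∑ i, (cycleWeight (τ ℓ i)).mapDomain (ℓ.1 * ·) := by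
      refine Finset.sum_congr rfl fun ℓ _ => Finset.sum_congr rfl fun i _ => ?_
      rw [← hbase, Finset.sum_congr rfl (g := fun _ => S (u (CycleIndex.base ℓ i))),
        Finset.sum_const, Finset.card_univ, Fintype.card_fin]
      intro j _
      rw [← hS' j (u (CycleIndex.base ℓ i)), iterate_enumeration hu]
      simp [Nat.mod_eq_of_lt j.2]

/-- A permutation with `k ℓ` cycles of length `ℓ` admits an enumeration of its cycles. -/
theorem exists_enumeration [Finite U] (g : Equiv.Perm U) (hN : Nat.card U ≤ N)
    (hk : ∀ ℓ : Len N, cycleCount g ℓ.1 = k ℓ) :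
    ∃ u : CycleIndex k ≃ U, ∀ c, g (u c) = u c.next := by
  classical
  -- `S ℓ` is the set of cycles of length `ℓ`, numbered by `E ℓ`, with base points `b ℓ i`
  let S : Len N → Set (Set U) := fun ℓ =>
    {c | (∃ x, c = {y | g.SameCycle x y}) ∧ c.ncard = ℓ.1}
  have hcard : ∀ ℓ, Nat.card (S ℓ) = k ℓ := fun ℓ => by rw [← hk]; rfl
  let E : ∀ ℓ, Fin (k ℓ) ≃ S ℓ := fun ℓ =>
    (finCongr (hcard ℓ).symm).trans (Finite.equivFin (S ℓ)).symm
  choose b hb using fun ℓ i => (E ℓ i).2.1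
  have hper : ∀ ℓ i, minimalPeriod g (b ℓ i) = ℓ.1 := fun ℓ i => by
    rw [← ncard_sameCycle, ← hb]
    exact (E ℓ i).2.2
  let u : CycleIndex k → U := fun c => g^[c.2.2] (b c.1 c.2.1)
  have hmem : ∀ c : CycleIndex k, g.SameCycle (b c.1 c.2.1) (u c) := fun c =>
    (sameCycle_iff_exists_iterate g).2 ⟨c.2.2, by rw [hper]; exact c.2.2.2, rfl⟩
  have hinj : Injective u := by
    intro c c' h
    have hsame : g.SameCycle (b c.1 c.2.1) (b c'.1 c'.2.1) :=
      (hmem c).trans (h ▸ (hmem c').symm)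
    obtain ⟨ℓ, i, j⟩ := c
    obtain ⟨ℓ', i', j'⟩ := c'
    obtain rfl : ℓ = ℓ' := by
      have := SameCycle.minimalPeriod_eq hsame
      rw [hper, hper] at this
      exact Subtype.ext (PNat.eq this)
    obtain rfl : i = i' := by
      apply (E ℓ).injective
      apply Subtype.ext
      rw [hb, hb]
      exact (sameCycle_class_eq_iff g).2 hsame
    have hj : (j : ℕ) = j' := iterate_injOn_Iio_minimalPeriod (f := g) (x := b ℓ i)
      (by rw [hper]; exact j.2) (by rw [hper]; exact j'.2) h
    rw [Fin.ext hj]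
  have hsurj : Surjective u := by
    intro y
    have hle : minimalPeriod g y ≤ N := by
      rw [← ncard_sameCycle]
      exact (Set.ncard_le_card _).trans hN
    let ℓ : Len N := ⟨period g y, hle⟩
    obtain ⟨i, hi⟩ := (E ℓ).surjective
      ⟨{z | g.SameCycle y z}, ⟨y, rfl⟩, ncard_sameCycle g y⟩
    have hy : g.SameCycle (b ℓ i) y := by
      rw [← sameCycle_class_eq_iff, ← hb, hi]
    obtain ⟨j, hj, hjy⟩ := (sameCycle_iff_exists_iterate g).1 hy
    exact ⟨⟨ℓ, i, ⟨j, by rwa [hper] at hj⟩⟩, hjy⟩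
  refine ⟨Equiv.ofBijective u ⟨hinj, hsurj⟩, fun c => ?_⟩
  change g (g^[c.2.2] (b c.1 c.2.1)) = g^[(c.2.2 + 1) % c.1.1] (b c.1 c.2.1)
  have hmod := iterate_mod_minimalPeriod_eq (f := g) (x := b c.1 c.2.1) (n := c.2.2 + 1)
  rw [hper] at hmod
  rw [hmod, iterate_succ_apply']

end Extension

/-! ### Cycle types of translations, and the exceptional cases -/

section SmallCycleTypes

open Function

theorem CT_of_minimalPeriod_eq {Ω : Type*} [Fintype Ω] {σ : Equiv.Perm Ω} (q : ℕ+)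
    (h : ∀ x, minimalPeriod σ x = q) {m : ℕ} (hm : Fintype.card Ω = q * m) :
    CT σ = X q ^ m := by
  have h' : ∀ x, period σ x = q := fun x => PNat.eq (h x)
  have hq : ((q : ℕ) : ℚ) ≠ 0 := by exact_mod_cast q.ne_zero
  rw [X_pow_eq_monomial]
  apply CT_eq_monomial_of_cycleWeight
  rw [cycleWeight]
  simp_rw [h']
  ext n
  rw [Finset.sum_const, Finset.card_univ, hm, castExponent_apply, Finsupp.smul_apply,
    Finsupp.single_apply, Finsupp.single_apply]
  split_ifs
  · rw [nsmul_eq_mul, Nat.cast_mul, mul_right_comm, mul_inv_cancel₀ hq, one_mul]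
  · simp

theorem affinePerm_apply {F : Type*} [Field F] {d : ℕ} (M : GL (Fin d) F) (v x : Fin d → F) :
    affinePerm M v x = x ᵥ* (M : Matrix (Fin d) (Fin d) F) + v := rfl

theorem affinePerm_one_apply {F : Type*} [Field F] {d : ℕ} (v x : Fin d → F) :
    affinePerm 1 v x = x + v := by
  rw [affinePerm_apply, Units.val_one, vecMul_one]

variable {p : ℕ} [Fact p.Prime] {d : ℕ}

theorem CT_affinePerm_one_zero : CT (affinePerm (1 : GL (Fin d) (ZMod p)) 0) = X 1 ^ p ^ d := by
  refine CT_of_minimalPeriod_eq 1 (fun x => ?_) (by simp [ZMod.card])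
  exact minimalPeriod_eq_one_iff_isFixedPt.2 (by rw [IsFixedPt, affinePerm_one_apply, add_zero])

theorem CT_affinePerm_one {v : Fin d → ZMod p} (hv : v ≠ 0) {q : ℕ+} (hq : (q : ℕ) = p) {m : ℕ}
    (hm : p ^ d = p * m) : CT (affinePerm (1 : GL (Fin d) (ZMod p)) v) = X q ^ m := by
  have hiter : ∀ (n : ℕ) x, (affinePerm (1 : GL (Fin d) (ZMod p)) v)^[n] x = x + n • v := by
    intro n x
    induction n with
    | zero => simp
    | succ n ih => rw [iterate_succ_apply', ih, affinePerm_one_apply, succ_nsmul, add_assoc]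
  refine CT_of_minimalPeriod_eq q (fun x => ?_) (by simp [ZMod.card, hq, hm])
  rw [hq]
  refine minimalPeriod_eq_prime ?_ fun h => hv ?_
  · rw [IsPeriodicPt, IsFixedPt, hiter]
    ext i
    simp
  · rwa [IsFixedPt, affinePerm_one_apply, add_eq_left] at h

end SmallCycleTypes

theorem one_mem_CGL {F : Type*} [Field F] (h : (2 : F) ≠ 0) {d : ℕ} : 1 ∈ CGL d F := by
  refine mem_CGL_iff.2 fun x hx => ?_
  rw [Units.val_one, vecMul_one] at hx
  ext i
  have hi : x i = -x i := congrFun hx i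
  exact (mul_eq_zero.1 (show 2 * x i = 0 by linear_combination hi)).resolve_left h

section OrderThree

open Function

/-- A matrix of order three over the field with two elements. -/
def orderThree : GL (Fin 2) (ZMod 2) where
  val := !![0, 1; 1, 1]
  inv := !![1, 1; 1, 0]
  val_inv := by decide
  inv_val := by decide

theorem orderThree_mem_CGL : orderThree ∈ CGL 2 (ZMod 2) :=
  mem_CGL_iff.2 (by change ∀ x, x ᵥ* !![0, 1; 1, 1] = -x → x = 0; decide)

theorem orderThree_inv_mem_CGL : orderThree⁻¹ ∈ CGL 2 (ZMod 2) :=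
  mem_CGL_iff.2 (by change ∀ x, x ᵥ* !![1, 1; 1, 0] = -x → x = 0; decide)

theorem orderThree_mul_self : orderThree * orderThree = orderThree⁻¹ :=
  Units.ext (by change !![0, 1; 1, 1] * !![0, 1; 1, 1] = !![1, 1; 1, 0]; decide)

theorem CT_orderThree : CT (affinePerm orderThree 0) = X 1 * X 3 := by
  have h0 : period (affinePerm orderThree 0) 0 = 1 := PNat.eq <|
    minimalPeriod_eq_one_iff_isFixedPt.2 (by
      rw [IsFixedPt, affinePerm_apply, zero_vecMul, add_zero])
  have h3 : ∀ x, x ≠ 0 → period (affinePerm orderThree 0) x = 3 := fun x hx => PNat.eq <|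
    minimalPeriod_eq_prime (hp := ⟨Nat.prime_three⟩)
      (by
        change ((x ᵥ* !![0, 1; 1, 1] + 0) ᵥ* !![0, 1; 1, 1] + 0) ᵥ* !![0, 1; 1, 1] + 0 = x
        revert x; decide)
      (by
        change x ᵥ* !![0, 1; 1, 1] + 0 ≠ x
        revert x; decide)
  have hX : (X 1 * X 3 : MvPolynomial ℕ+ ℚ) =
      monomial (Finsupp.single 1 1 + Finsupp.single 3 1) 1 := by
    rw [X, X, monomial_mul, one_mul]
  rw [hX]
  apply CT_eq_monomial_of_cycleWeight
  rw [cycleWeight, ← Finset.add_sum_erase _ _ (Finset.mem_univ 0), h0,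
    Finset.sum_congr rfl (g := fun _ => Finsupp.single 3 ((3 : ℕ) : ℚ)⁻¹), Finset.sum_const,
    Finset.card_erase_of_mem (Finset.mem_univ 0), Finset.card_univ]
  · ext n
    simp only [castExponent_apply, Finsupp.add_apply, Finsupp.smul_apply, Finsupp.single_apply]
    simp [ZMod.card]
  · intro x hx
    rw [h3 x (Finset.ne_of_mem_erase hx)]
    rfl

end OrderThree

/-- Every cycle type in `Γ(d, p, ℓ)` is that of an affine permutation whose linear part is a
product of `ℓ` matrices without eigenvalue `-1`. -/
theorem exists_factorization_of_mem_Gam {d p : ℕ} [hp : Fact p.Prime] (hd : 0 < d) (ℓ : ℕ+)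
    {γ : MvPolynomial ℕ+ ℚ} (hγ : γ ∈ Gam d p ℓ) :
    ∃ (M : Fin (ℓ : ℕ) → GL (Fin d) (ZMod p)) (w : Fin d → ZMod p),
      (∀ j, M j ∈ CGL d (ZMod p)) ∧ γ = CT (affinePerm (List.ofFn M).prod w) := by
  have htwo : (2 : ZMod 3) ≠ 0 := by decide
  by_cases hℓ : ℓ = 1
  · subst hℓ
    rw [Gam, if_pos rfl] at hγ
    obtain ⟨_, ⟨A, hA, v, rfl⟩, rfl⟩ := hγ
    exact ⟨fun _ => A, v, fun _ => hA, by simp⟩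
  obtain ⟨n, hn⟩ : ∃ n, (ℓ : ℕ) = n + 2 := by
    have h1 : (ℓ : ℕ) ≠ 1 := fun h => hℓ (PNat.eq h)
    have := ℓ.pos
    exact ⟨ℓ - 2, by omega⟩
  rw [hn]
  rw [Gam, if_neg hℓ] at hγ
  split_ifs at hγ with h1 h2 h3
  · exact absurd hγ (Set.notMem_empty _)
  · obtain ⟨rfl, rfl⟩ := Prod.mk.inj h2
    have hone : (1 : GL (Fin 1) (ZMod 3)) ∈ CGL 1 (ZMod 3) :=
      one_mem_CGL htwo
    obtain ⟨M, hM, hprod⟩ := exists_prod_of_forall_exists_mul {1}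
      (fun M hM => ⟨1, hone, 1, hone, rfl, by rw [hM, one_mul]⟩) n 1 rfl
    rcases hγ with rfl | rfl
    · exact ⟨M, 0, hM, by rw [hprod, CT_affinePerm_one_zero]; rfl⟩
    · refine ⟨M, fun _ => 1, hM, ?_⟩
      rw [hprod, CT_affinePerm_one (p := 3) (d := 1) (v := fun _ => 1) (q := 3) (m := 1)
        (fun h => one_ne_zero (congrFun h 0)) rfl rfl, pow_one]
  · obtain ⟨rfl, rfl⟩ := Prod.mk.inj h3
    have hA := orderThree_mem_CGL
    have hA' := orderThree_inv_mem_CGL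
    have hS := exists_prod_of_forall_exists_mul {1, orderThree, orderThree⁻¹}
      (by
        rintro M (rfl | rfl | rfl)
        · exact ⟨_, hA, _, hA', by simp, mul_inv_cancel _⟩
        · refine ⟨_, hA', _, hA', by simp, ?_⟩
          rw [← _root_.mul_inv_rev, orderThree_mul_self, inv_inv]
        · exact ⟨_, hA, _, hA, by simp, orderThree_mul_self⟩) n
    obtain ⟨M, hM, hprod⟩ := hS 1 (by simp)
    obtain ⟨M', hM', hprod'⟩ := hS orderThree (by simp)
    rcases hγ with rfl | rfl | rfl
    · exact ⟨M, 0, hM, by rw [hprod, CT_affinePerm_one_zero]; rfl⟩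
    · refine ⟨M, fun _ => 1, hM, ?_⟩
      rw [hprod, CT_affinePerm_one (p := 2) (d := 2) (v := fun _ => 1) (q := 2) (m := 2)
        (fun h => one_ne_zero (congrFun h 0)) rfl rfl]
    · exact ⟨M', 0, hM', by rw [hprod', CT_orderThree]⟩
  · obtain ⟨_, ⟨A, v, rfl⟩, rfl⟩ := hγ
    obtain ⟨M, hM, hprod⟩ := exists_prod_of_forall_exists_mul Set.univ
      (fun M _ => by
        obtain ⟨B, hB, C, hC, h⟩ := exists_mul_of_hasSeparator M
          (hasSeparator_of_prime hd (by simp) h1 h2 h3 _ fun v hv => by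
            rw [vecMulLinear_apply] at hv
            rw [← vecMul_one v, ← Units.val_one, ← mul_inv_cancel M, Units.val_mul,
              ← vecMul_vecMul, hv, zero_vecMul])
        exact ⟨B, hB, C, hC, Set.mem_univ _, h⟩) n A (Set.mem_univ _)
    exact ⟨M, v, hM, by rw [hprod]⟩

/-! ### The explicit map -/

section ExplicitMap

open Function

variable {F : Type*} [Field F] {d N : ℕ} {U : Type*} {k : Len N → ℕ}
  {u : CycleIndex k ≃ U} {M : ∀ ℓ : Len N, Fin (k ℓ) → Fin (ℓ.1 : ℕ) → GL (Fin d) F}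
  {w : ∀ ℓ : Len N, Fin (k ℓ) → Fin d → F} {g : U → U}

theorem alpha_enumeration (c : CycleIndex k) : alpha u M (u c) = M c.1 c.2.1 c.2.2 := by
  rw [alpha, u.symm_apply_apply]

theorem omega_enumeration (c : CycleIndex k) :
    omega u w (u c) = if (c.2.2 : ℕ) + 1 < (c.1.1 : ℕ) then 0 else w c.1 c.2.1 := by
  rw [omega, u.symm_apply_apply]

variable [AddCommGroup U]

theorem explicitMap_apply (hu : ∀ c, g (u c) = u c.next) (y : Fin d → F) (x : U) :
    explicitMap u M w (y, x) = (affinePerm (alpha u M x) (omega u w x) y, g x) := by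
  have hx : g x = x + nu u x := by
    rw [nu, ← hu, u.apply_symm_apply, add_sub_cancel]
  rw [hx]
  rfl

theorem explicitMap_iterate_base (hu : ∀ c, g (u c) = u c.next) (ℓ : Len N) (i : Fin (k ℓ))
    (y : Fin d → F) (n : ℕ) (hn : n < ℓ.1) :
    (explicitMap u M w)^[n] (y, u (CycleIndex.base ℓ i)) =
      (y ᵥ* (((List.ofFn (M ℓ i)).take n).prod : GL (Fin d) F).1, u ⟨ℓ, i, ⟨n, hn⟩⟩) := by
  induction n with
  | zero => simp [CycleIndex.base]
  | succ n ih =>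
    rw [iterate_succ_apply', ih (by omega), explicitMap_apply hu, hu, Prod.mk.injEq]
    constructor
    · rw [List.prod_take_succ _ _ (by simpa using (by omega : n < ℓ.1)), Units.val_mul,
        ← vecMul_vecMul, affinePerm_apply, alpha_enumeration, omega_enumeration, if_pos hn]
      simp
    · simp [CycleIndex.next, Nat.mod_eq_of_lt hn]

/-- The return map of the explicit map on the fibre of `u_{ℓ,i,0}`: the translation `w_{ℓ,i}`
enters only at the last step. -/
theorem explicitMap_iterate_len (hu : ∀ c, g (u c) = u c.next) (ℓ : Len N) (i : Fin (k ℓ))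
    (y : Fin d → F) :
    (explicitMap u M w)^[ℓ.1] (y, u (CycleIndex.base ℓ i)) =
      (affinePerm (List.ofFn (M ℓ i)).prod (w ℓ i) y, u (CycleIndex.base ℓ i)) := by
  obtain ⟨n, hn⟩ : ∃ n, (ℓ.1 : ℕ) = n + 1 := ⟨ℓ.1 - 1, by have := ℓ.1.pos; omega⟩
  have hlen : n < (List.ofFn (M ℓ i)).length := by rw [List.length_ofFn]; omega
  have hprod : (List.ofFn (M ℓ i)).prod =
      ((List.ofFn (M ℓ i)).take n).prod * M ℓ i ⟨n, by omega⟩ := by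
    have htake : (List.ofFn (M ℓ i)).take (n + 1) = List.ofFn (M ℓ i) :=
      List.take_of_length_le (by rw [List.length_ofFn, hn])
    rw [← congrArg List.prod htake, List.prod_take_succ _ _ hlen, List.getElem_ofFn]
  have hit : (explicitMap u M w)^[ℓ.1] = (explicitMap u M w)^[n + 1] := congrArg _ hn
  rw [hit, iterate_succ_apply', explicitMap_iterate_base hu ℓ i y n (by omega),
    explicitMap_apply hu, hu, Prod.mk.injEq]
  constructor
  · rw [hprod, affinePerm_apply, affinePerm_apply, Units.val_mul, ← vecMul_vecMul,
      alpha_enumeration, omega_enumeration, if_neg (by simp [hn])]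
  · simp [CycleIndex.next, CycleIndex.base, hn]

theorem explicitMap_injective (hu : ∀ c, g (u c) = u c.next) (hg : Injective g) :
    Injective (explicitMap u M w) := by
  rintro ⟨y, x⟩ ⟨y', x'⟩ h
  rw [explicitMap_apply hu, explicitMap_apply hu, Prod.mk.injEq] at h
  obtain rfl := hg h.2
  rw [(affinePerm _ _).injective h.1]

theorem explicitMap_add_self_injective (hu : ∀ c, g (u c) = u c.next)
    (hg : Injective fun x => g x + x) (hM : ∀ ℓ i j, M ℓ i j ∈ CGL d F) :
    Injective fun z => explicitMap u M w z + z := by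
  rintro ⟨y, x⟩ ⟨y', x'⟩ h
  simp only [explicitMap_apply hu, Prod.mk_add_mk, Prod.mk.injEq] at h
  obtain rfl := hg h.2
  have hα : alpha u M x ∈ CGL d F := hM _ _ _
  have h0 : y - y' = 0 := by
    apply mem_CGL_iff.1 hα
    have h1 := h.1
    rw [affinePerm_apply, affinePerm_apply] at h1
    rw [sub_vecMul]
    linear_combination h1
  rw [sub_eq_zero.1 h0]

theorem isCosetwiseAffine_of_explicitMap [Module F U] {V : Type*} [AddCommGroup V] [Module F V]
    (hu : ∀ c, g (u c) = u c.next) (e : ((Fin d → F) × U) ≃ₗ[F] V) {f : V → V}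
    (hf : ∀ z, f (e z) = e (explicitMap u M w z)) :
    IsCosetwiseAffine ((LinearMap.range (LinearMap.inl F (Fin d → F) U)).map e.toLinearMap) f := by
  intro C
  obtain ⟨c, rfl⟩ := Submodule.mkQ_surjective _ C
  obtain ⟨⟨y₀, x⟩, rfl⟩ := e.surjective c
  refine ⟨e (omega u w x, g x), e.toLinearMap ∘ₗ
    (LinearMap.prodMap (vecMulLinear (alpha u M x : Matrix (Fin d) (Fin d) F)) 0) ∘ₗ
    e.symm.toLinearMap, ?_, fun z hz => ?_⟩
  · rintro _ ⟨_, ⟨a, rfl⟩, rfl⟩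
    exact ⟨_, ⟨a ᵥ* (alpha u M x : Matrix (Fin d) (Fin d) F), rfl⟩, by simp⟩
  · rw [Submodule.mkQ_apply, Submodule.mkQ_apply, Submodule.Quotient.eq] at hz
    obtain ⟨_, ⟨a, rfl⟩, ha⟩ := hz
    obtain ⟨⟨y, x'⟩, rfl⟩ := e.surjective z
    rw [LinearEquiv.coe_coe, ← map_sub, e.injective.eq_iff] at ha
    have hx : x' = x := by
      have := congrArg Prod.snd ha
      simp only [LinearMap.inl_apply, Prod.snd_sub] at this
      exact sub_eq_zero.1 this.symm
    subst hx
    rw [hf, explicitMap_apply hu]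
    simp [← map_add, affinePerm_apply]

end ExplicitMap

/-- Every subspace of the right dimension is the first summand of a direct sum decomposition. -/
theorem exists_linearEquiv_prod_map_inl {F : Type*} [Field F] {d t : ℕ}
    (W : Submodule F (Fin (d + t) → F)) (hW : Module.finrank F W = d) :
    ∃ e : ((Fin d → F) × (Fin t → F)) ≃ₗ[F] (Fin (d + t) → F),
      (LinearMap.range (LinearMap.inl F (Fin d → F) (Fin t → F))).map e.toLinearMap = W := by
  obtain ⟨Q, hQ⟩ := Submodule.exists_isCompl W
  have hsum := Submodule.finrank_add_eq_of_isCompl hQ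
  rw [hW, Module.finrank_fin_fun, Nat.add_left_cancel_iff] at hsum
  let eW : (Fin d → F) ≃ₗ[F] W := LinearEquiv.ofFinrankEq _ _ (by simp [hW])
  let eQ : (Fin t → F) ≃ₗ[F] Q := LinearEquiv.ofFinrankEq _ _ (by simp [hsum])
  refine ⟨(eW.prodCongr eQ).trans (Submodule.prodEquivOfIsCompl W Q hQ), ?_⟩
  ext z
  constructor
  · rintro ⟨_, ⟨a, rfl⟩, rfl⟩
    simp
  · intro hz
    exact ⟨_, ⟨eW.symm ⟨z, hz⟩, rfl⟩, by simp⟩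

end

end CompleteMappings

open CompleteMappings in
theorem theorem1p4 (p : ℕ) [Fact p.Prime] (d t : ℕ) (hd : 0 < d) (ht : 0 < t)
    (k : Len (p ^ t) → ℕ)
    (g : Equiv.Perm (Fin t → ZMod p)) (hg : IsCompleteMapping g)
    (hgk : CT g = ∏ ℓ : Len (p ^ t), MvPolynomial.X ℓ.1 ^ k ℓ)
    (γ : ∀ ℓ : Len (p ^ t), Fin (k ℓ) → MvPolynomial ℕ+ ℚ)
    (hγ : ∀ ℓ i, γ ℓ i ∈ Gam d p ℓ.1) :
    -- existence, for every subspace of dimension `d`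
    (∀ W : Submodule (ZMod p) (Fin (d + t) → ZMod p), Module.finrank (ZMod p) W = d →
      ∃ f : Equiv.Perm (Fin (d + t) → ZMod p),
        IsCosetwiseAffine W f ∧ IsCompleteMapping f ∧
        CT f = ∏ ℓ : Len (p ^ t), ∏ i : Fin (k ℓ), BU ℓ.1 (γ ℓ i)) ∧
    -- each `γ ℓ i` comes from a product of `ℓ` matrices in `CGL`
    (∀ ℓ i, ∃ (M : Fin (ℓ.1 : ℕ) → GL (Fin d) (ZMod p)) (w : Fin d → ZMod p),
      (∀ j, M j ∈ CGL d (ZMod p)) ∧ γ ℓ i = CT (affinePerm (List.ofFn M).prod w)) ∧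
    -- explicit form: any enumeration `u` of the cycles of `g`, any such factorizations, and any
    -- identification `e` of `F_p ^ d ⊕ F_p ^ t` with `F_p ^ (d + t)`
    (∀ u : CycleIndex k ≃ (Fin t → ZMod p), (∀ c, g (u c) = u c.next) →
      ∀ (M : ∀ ℓ : Len (p ^ t), Fin (k ℓ) → Fin (ℓ.1 : ℕ) → GL (Fin d) (ZMod p))
        (w : ∀ ℓ : Len (p ^ t), Fin (k ℓ) → Fin d → ZMod p),
        (∀ ℓ i j, M ℓ i j ∈ CGL d (ZMod p)) →
        (∀ ℓ i, γ ℓ i = CT (affinePerm (List.ofFn (M ℓ i)).prod (w ℓ i))) →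
      ∀ e : ((Fin d → ZMod p) × (Fin t → ZMod p)) ≃ₗ[ZMod p] (Fin (d + t) → ZMod p),
      ∃ f : Equiv.Perm (Fin (d + t) → ZMod p),
        (∀ z, f (e z) = e (explicitMap u M w z)) ∧
        IsCosetwiseAffine
          ((LinearMap.range (LinearMap.inl (ZMod p) (Fin d → ZMod p) (Fin t → ZMod p))).map
            e.toLinearMap) f ∧
        IsCompleteMapping f ∧
        CT f = ∏ ℓ : Len (p ^ t), ∏ i : Fin (k ℓ), BU ℓ.1 (γ ℓ i)) := by
  have hcount : ∀ ℓ : Len (p ^ t), cycleCount g ℓ.1 = k ℓ := fun ℓ => by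
    rw [CT_eq_monomial, prod_X_pow_len] at hgk
    rw [← cycleExponent_apply, MvPolynomial.monomial_left_injective one_ne_zero hgk,
      sum_single_len_apply]
  have hfact := fun ℓ i => exists_factorization_of_mem_Gam hd ℓ.1 (hγ ℓ i)
  have hexplicit : ∀ u : CycleIndex k ≃ (Fin t → ZMod p), (∀ c, g (u c) = u c.next) →
      ∀ (M : ∀ ℓ : Len (p ^ t), Fin (k ℓ) → Fin (ℓ.1 : ℕ) → GL (Fin d) (ZMod p))
        (w : ∀ ℓ : Len (p ^ t), Fin (k ℓ) → Fin d → ZMod p),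
        (∀ ℓ i j, M ℓ i j ∈ CGL d (ZMod p)) →
        (∀ ℓ i, γ ℓ i = CT (affinePerm (List.ofFn (M ℓ i)).prod (w ℓ i))) →
      ∀ e : ((Fin d → ZMod p) × (Fin t → ZMod p)) ≃ₗ[ZMod p] (Fin (d + t) → ZMod p),
      ∃ f : Equiv.Perm (Fin (d + t) → ZMod p),
        (∀ z, f (e z) = e (explicitMap u M w z)) ∧
        IsCosetwiseAffine
          ((LinearMap.range (LinearMap.inl (ZMod p) (Fin d → ZMod p) (Fin t → ZMod p))).map
            e.toLinearMap) f ∧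
        IsCompleteMapping f ∧
        CT f = ∏ ℓ : Len (p ^ t), ∏ i : Fin (k ℓ), BU ℓ.1 (γ ℓ i) := by
    intro u hu M w hM hMw e
    let f₀ : Equiv.Perm ((Fin d → ZMod p) × (Fin t → ZMod p)) := Equiv.ofBijective _
      (Finite.injective_iff_bijective.1 (explicitMap_injective (M := M) (w := w) hu g.injective))
    let f : Equiv.Perm (Fin (d + t) → ZMod p) := e.symm.toEquiv.trans (f₀.trans e.toEquiv)
    have hf : ∀ z, f (e z) = e (explicitMap u M w z) := fun z =>
      congrArg (fun x => e (f₀ x)) (e.symm_apply_apply z)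
    refine ⟨f, hf, isCosetwiseAffine_of_explicitMap hu e hf, ⟨f.bijective, ?_⟩, ?_⟩
    · rw [← Finite.injective_iff_bijective]
      intro z z' h
      obtain ⟨y, rfl⟩ := e.surjective z
      obtain ⟨y', rfl⟩ := e.surjective z'
      simp only [hf, ← map_add, e.injective.eq_iff] at h ⊢
      exact explicitMap_add_self_injective hu hg.2.injective hM h
    · simp_rw [hMw]
      refine CT_eq_prod_of_cycleWeight f _
        (fun (ℓ : Len (p ^ t)) i => affinePerm (List.ofFn (M ℓ i)).prod (w ℓ i)) ?_
      rw [cycleWeight_of_semiconj e.toEquiv (σ := f₀) hf]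
      exact cycleWeight_extension (explicitMap_apply hu) hu _ (explicitMap_iterate_len hu)
  refine ⟨fun W hW => ?_, hfact, hexplicit⟩
  obtain ⟨u, hu⟩ := exists_enumeration g (by simp [ZMod.card]) hcount
  choose M w hM hMw using hfact
  obtain ⟨e, rfl⟩ := exists_linearEquiv_prod_map_inl W hW
  obtain ⟨f, -, h⟩ := hexplicit u hu M w hM hMw e
  exact ⟨f, h⟩
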